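/- Let $G$ be a finite nontrivial group and let $n\ge 2$. Let $V$ be the set of triples $(I,\pi,[f]_\pi)$ where $I\subseteq\{1,\dots,n\}$ has two elements, $\pi$ is the partition of $I$ with a single block, and $[f]_\pi$ is the class of a function $f:I\to G$ modulo left multiplication by constants of $G$. A vertex $a=(\{i,j\},\pi,[f]_\pi)\in V$ with $f(i)^{-1}f(j)=g$ is represented by the pair of inverse labelled arrows $i\xrightarrow{g}j$ and $j\xrightarrow{g^{-1}}i$. For $Z\subseteq V$, let $\Gamma(Z)$ be the directed labelled graph formed by the arrows of all $a\in Z$, and let $\Gamma_0(Z)$ be the undirected multigraph, on the same vertices, with one edge $i - j$ for each $a\in Z$ with $I=\{i,j\}$. Call $\Gamma(Z)$ $G$-trivial if $g_1g_2\cdots g_m=1$ for every cycle $q_0\xrightarrow{g_1}q_1\xrightarrow{g_2}\cdots\xrightarrow{g_m}q_m=q_0$ in $\Gamma(Z)$, and $G$-nontrivial otherwise. A multigraph is unicyclic if it is connected, has no loops, and has as many vertices as edges. The reduced Rhodes matroid $\mathcal H=(V,H)$ defined by $G$ and $n$ is given by the family $H$ of all $Z\subseteq V$ such that each connected component of $\Gamma_0(Z)$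 is a tree or unicyclic, at most one component is unicyclic, and, if some component is unicyclic, then $\Gamma(Z)$ is $G$-nontrivial. For $k\ge 0$ let $H_k=\{X\in H : |X|\le k\}$, and for $k\ge 1$ let $$T(H_k)=\{T\subseteq V : X\cup\{p\}\in H_k \text{ for all } X\in H_{k-1} \text{ with } X\subseteq T \text{ and all } p\in V\setminus T\}.$$ For a family $R$ of subsets of $V$, let $\mathcal J(R)=(V,J(R))$, where $J(R)$ is the family of all sets $\{x_1,\dots,x_m\}$ ($m\ge 0$) for which there is a chain $R_0\subset R_1\subset\cdots\subset R_m$ in $R$ with $x_i\in R_i\setminus R_{i-1}$ for $i=1,\dots,m$. Then: 1. $\mathcal H=\mathcal J(T(H_k))$ for every $k\ge 4$. 2. The bound $k\ge 4$ is optimal: if $n\ge 4$, then $\mathcal H\ne\mathcal J(T(H_k))$ for every $1\le k\le 3$ (and every finite nontrivial group $G$). -/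

import Mathlib

namespace ReducedRhodes

/-! ### Families of faces, truncation, the operators `T` and `J`

A simplicial complex with vertex set (type) `V` is represented by its family of faces,
a `Set (Set V)` (the empty face included). -/

section Complexes

variable {V : Type*}

/-- The faces of the `k`-truncation: the faces with at most `k` elements. -/
def trunc (H : Set (Set V)) (k : ℕ) : Set (Set V) :=
  {X | X ∈ H ∧ X.encard ≤ (k : ℕ∞)}

/-- The family `T(H_k)` for `k ≥ 1`: all `T ⊆ V` such that `X ∪ {p} ∈ H_k` for every
`X ∈ H_{k-1}` with `X ⊆ T` and every `p ∈ V \ T`. -/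
def truncFlats (H : Set (Set V)) (k : ℕ) : Set (Set V) :=
  {T | ∀ X ∈ trunc H (k - 1), X ⊆ T → ∀ p, p ∉ T → insert p X ∈ trunc H k}

/-- The family `J(R)`: all sets `{x₁, …, x_m}` that are transversals of the successive differences
of a chain `R₀ ⊂ R₁ ⊂ ⋯ ⊂ R_m` in `R`, that is, `x_i ∈ R_i \ R_{i-1}` for `i = 1, …, m`. -/
def transversals (R : Set (Set V)) : Set (Set V) :=
  {X | ∃ (m : ℕ) (c : Fin (m + 1) → Set V) (x : Fin m → V),
    (∀ i, c i ∈ R) ∧ StrictMono c ∧ (∀ i : Fin m, x i ∈ c i.succ \ c i.castSucc) ∧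
    X = Set.range x}

end Complexes

/-! ### Connectedness, trees and unicyclic multigraphs -/

section Multigraphs

variable {α β : Type*}

/-- A walk from `x` to `y` in a multigraph, with the list of the edges that it uses. -/
inductive IsWalk (Γ : Graph α β) : α → List β → α → Prop
  | nil (x : α) (hx : x ∈ Γ.vertexSet) : IsWalk Γ x [] x
  | cons {x y z : α} {e : β} {l : List β} (h : Γ.IsLink e x y) (w : IsWalk Γ y l z) :
      IsWalk Γ x (e :: l) z

/-- A multigraph is connected if it is nonempty and any two of its vertices are joined by a
walk. -/
def IsConnected (Γ : Graph α β) : Prop :=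
  Γ.vertexSet.Nonempty ∧
    ∀ x ∈ Γ.vertexSet, ∀ y ∈ Γ.vertexSet, ∃ l, IsWalk Γ x l y

/-- A tree: a connected multigraph without cycles, that is, without a nonempty closed walk using no
edge twice. -/
def IsTree (Γ : Graph α β) : Prop :=
  IsConnected Γ ∧ ∀ x l, IsWalk Γ x l x → l.Nodup → l = []

/-- A unicyclic multigraph: connected, without loops, with as many vertices as edges. -/
def IsUnicyclic (Γ : Graph α β) : Prop :=
  IsConnected Γ ∧ (∀ e x, ¬ Γ.IsLoopAt e x) ∧ Γ.vertexSet.encard = Γ.edgeSet.encard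

/-- `C` is the vertex set of a connected component of `Γ`; the component itself is `Γ.induce C`. -/
def IsComponent (Γ : Graph α β) (C : Set α) : Prop :=
  ∃ x ∈ Γ.vertexSet, C = {y | ∃ l, IsWalk Γ x l y}

end Multigraphs

/-! ### The triples `(I, π, [f]_π)` -/

section SPC

variable {n : ℕ} {G : Type*} [Group G]

/-- `f ∼_π h` for functions `f, h : I → G`: on each block of `π`, the function `f` is a left
translate of `h` by a constant of `G`. -/
def simSetoid (G : Type*) [Group G] {I : Finset (Fin n)} (π : Finpartition I) :
    Setoid (I → G) where
  r f h := ∀ B ∈ π.parts, ∃ g : G, ∀ i : I, (i : Fin n) ∈ B → f i = g * h i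
  iseqv :=
    { refl := fun _ _ _ => ⟨1, fun _ _ => by simp⟩
      symm := fun {_ _} H B hB => by
        obtain ⟨g, hg⟩ := H B hB
        exact ⟨g⁻¹, fun i hi => by rw [hg i hi]; simp⟩
      trans := fun {_ _ _} H K B hB => by
        obtain ⟨g, hg⟩ := H B hB
        obtain ⟨k, hk⟩ := K B hB
        exact ⟨g * k, fun i hi => by rw [hg i hi, hk i hi, mul_assoc]⟩ }

/-- The set of triples `(I, π, [f]_π)` with `I` a subset of `{1, …, n}` (here `Fin n`), `π` a
partition of `I` and `f : I → G`. -/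
structure SPC (n : ℕ) (G : Type*) [Group G] where
  /-- The subset `I`. -/
  supp : Finset (Fin n)
  /-- The partition `π` of `I`. -/
  part : Finpartition supp
  /-- The class `[f]_π`. -/
  cls : Quotient (simSetoid G part)

/-- The vertex set of the reduced Rhodes matroid: the triples `(I, π, [f]_π)` with `|I| = 2` and `π`
the partition of `I` with a single block. -/
def Vert (n : ℕ) (G : Type*) [Group G] : Type _ :=
  {a : SPC n G // a.supp.card = 2 ∧ a.part.parts = {a.supp}}

/-- The directed labelled graph `Γ(a)` of a vertex `a = (I, π, [f]_π)` with `I = {i, j}`: it has an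
arrow from `i` to `j` with label `(f i)⁻¹ * f j`, and so also the inverse arrow from `j` to `i`. -/
def Arrow (a : Vert n G) (i : Fin n) (g : G) (j : Fin n) : Prop :=
  ∃ (hi : i ∈ a.1.supp) (hj : j ∈ a.1.supp), i ≠ j ∧
    ∃ f : a.1.supp → G, Quotient.mk (simSetoid G a.1.part) f = a.1.cls ∧
      (f ⟨i, hi⟩)⁻¹ * f ⟨j, hj⟩ = g

/-- Walks in the directed labelled graph `Γ(Z)`, whose arrows are those of the graphs `Γ(a)` with
`a ∈ Z`: `LabelledWalk Z i g j` says that there is a walk from `i` to `j` whose product of labels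
is `g`. -/
inductive LabelledWalk (Z : Set (Vert n G)) : Fin n → G → Fin n → Prop
  | nil (i : Fin n) : LabelledWalk Z i 1 i
  | cons {i j l : Fin n} {g h : G} (a : Vert n G) (ha : a ∈ Z) (hg : Arrow a i g j)
      (w : LabelledWalk Z j h l) : LabelledWalk Z i (g * h) l

/-- `Γ(Z)` is `G`-trivial: the product of the labels along each cycle
`q₀ → q₁ → ⋯ → q_m = q₀` is `1`. -/
def IsGTrivial (Z : Set (Vert n G)) : Prop :=
  ∀ (i : Fin n) (g : G), LabelledWalk Z i g i → g = 1

/-- The undirected multigraph `Γ₀(Z)`: it has one edge for each `a = (I, π, [f]_π) ∈ Z`, and this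
edge joins the two elements of `I`, that is, the ends of the pair of inverse arrows `Γ(a)`. -/
def undirected (Z : Set (Vert n G)) : Graph (Fin n) (Vert n G) where
  vertexSet := {i | ∃ a ∈ Z, i ∈ a.1.supp}
  IsLink a i j := a ∈ Z ∧ ∃ g, Arrow a i g j
  edgeSet := Z
  isLink_symm := by
    intro a _
    refine ⟨fun i j h => ?_⟩
    obtain ⟨ha, g, hi, hj, hne, f, hf, _⟩ := h
    exact ⟨ha, _, hj, hi, hne.symm, f, hf, rfl⟩
  eq_or_eq_of_isLink_of_isLink := by
    rintro a x y v w ⟨-, -, hx, -, -, -⟩ ⟨-, -, hv, hw, hvw, -⟩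
    obtain ⟨p, q, -, hpq⟩ := Finset.card_eq_two.1 a.2.1
    simp only [hpq, Finset.mem_insert, Finset.mem_singleton] at hx hv hw
    grind
  edge_mem_iff_exists_isLink := by
    intro a
    refine ⟨fun ha => ?_, fun ⟨_, _, h⟩ => h.1⟩
    obtain ⟨p, q, hne, hpq⟩ := Finset.card_eq_two.1 a.2.1
    obtain ⟨f, hf⟩ := Quotient.exists_rep a.1.cls
    exact ⟨p, q, ha, _, by simp [hpq], by simp [hpq], hne, f, hf, rfl⟩
  left_mem_of_isLink := by
    rintro a x y ⟨ha, -, hx, -⟩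
    exact ⟨a, ha, hx⟩

/-- The faces (independent sets) of the reduced Rhodes matroid defined by `G` and `n`: the sets `Z`
of vertices such that each connected component of `Γ₀(Z)` is a tree or unicyclic, at most one is
unicyclic, and `Γ(Z)` is `G`-nontrivial if one is unicyclic. -/
def rhodes (n : ℕ) (G : Type*) [Group G] : Set (Set (Vert n G)) :=
  {Z | (∀ C, IsComponent (undirected Z) C →
          IsTree ((undirected Z).induce C) ∨ IsUnicyclic ((undirected Z).induce C)) ∧
       (∀ C D, IsComponent (undirected Z) C → IsComponent (undirected Z) D →
          IsUnicyclic ((undirected Z).induce C) → IsUnicyclic ((undirected Z).induce D) → C = D) ∧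
       ((∃ C, IsComponent (undirected Z) C ∧ IsUnicyclic ((undirected Z).induce C)) →
          ¬ IsGTrivial Z)}

end SPC

end ReducedRhodes

/-! Put r(Z) = n - `numClasses Z` + `excess Z`. Adding up the cyclomatic numbers of the components
shows that the faces are exactly the sets Z with |Z| ≤ r(Z) (`mem_rhodes_iff`): the total cyclomatic
number may be at most 1, and it may be 1 only if Z is G-nontrivial. Adding p raises r by one if p ∉
`cl Z` and leaves it unchanged otherwise, so `cl` governs the extension of faces
(`insert_mem_rhodes_iff`).

Consequently T(H_k) consists of the sets that contain the closures of their subsets of size at most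
k - 1 (`mem_truncFlats_iff`). All flats belong to it, and adding the elements of a face one at a
time gives a chain of flats; this yields H ⊆ J(T(H_k)). Conversely, if every member of T(H_k) is a
flat, then each transversal of a chain is a face.

For k ≥ 4 every member is a flat, because closures of three edges suffice
(`cl_subset_of_ncard_le_three`): two edges witness G-nontriviality or compose to a third, and one
more edge extends a path. For k ≤ 3 this fails: all edges on {i, j} together with a single edge on a
disjoint pair contain the closures of all their two-element subsets, but do not form a flat. -/

namespace ReducedRhodes

/-! ### Walks and trails in multigraphs -/

section Walks

variable {α β : Type*} {Γ : Graph α β}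

theorem IsWalk.left_mem {x y : α} {l : List β} (w : IsWalk Γ x l y) : x ∈ Γ.vertexSet := by
  cases w with
  | nil _ hx => exact hx
  | cons h _ => exact h.left_mem

theorem IsWalk.split {x z : α} {l₁ l₂ : List β} (w : IsWalk Γ x (l₁ ++ l₂) z) :
    ∃ y, IsWalk Γ x l₁ y ∧ IsWalk Γ y l₂ z := by
  induction l₁ generalizing x with
  | nil => exact ⟨x, .nil x w.left_mem, w⟩
  | cons e l ih =>
    cases w with
    | cons h w =>
      obtain ⟨y, h₁, h₂⟩ := ih w
      exact ⟨y, .cons h h₁, h₂⟩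

/-- Every walk contains a trail with the same ends. -/
theorem IsWalk.exists_nodup {x y : α} {l : List β} (w : IsWalk Γ x l y) :
    ∃ l', l'.Nodup ∧ l' ⊆ l ∧ IsWalk Γ x l' y := by
  induction w with
  | nil x hx => exact ⟨[], List.nodup_nil, by simp, .nil x hx⟩
  | @cons x y z e l h _ ih =>
    obtain ⟨l', hn, hs, w'⟩ := ih
    by_cases he : e ∈ l'
    -- Discard the part of the trail before `e`. If `e` is then traversed from `x`, keep it;
    -- otherwise it leads to `x`, and the trail after it already starts there.
    · obtain ⟨l₁, l₂, rfl⟩ := List.append_of_mem he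
      obtain ⟨a, -, w₂⟩ := w'.split
      have hn₂ : (e :: l₂).Nodup := (List.nodup_append.1 hn).2.1
      have hs₂ : e :: l₂ ⊆ e :: l := fun b hb =>
        List.mem_cons_of_mem _ (hs (List.mem_append_right _ hb))
      cases w₂ with
      | @cons _ b _ _ _ h' w₃ =>
        rcases h.eq_and_eq_or_eq_and_eq h' with ⟨rfl, rfl⟩ | ⟨rfl, rfl⟩
        · exact ⟨e :: l₂, hn₂, hs₂, .cons h' w₃⟩
        · exact ⟨l₂, hn₂.of_cons, fun c hc => hs₂ (List.mem_cons_of_mem _ hc), w₃⟩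
    · exact ⟨e :: l', List.nodup_cons.2 ⟨he, hn⟩, List.cons_subset_cons e hs, .cons h w'⟩

end Walks

/-! ### Vertices of the matroid as pairs of inverse arrows -/

section Arrows

variable {n : ℕ} {G : Type*} [Group G] {a b : Vert n G} {i j k l : Fin n} {g h : G}

theorem Arrow.ne (H : Arrow a i g j) : i ≠ j := by
  obtain ⟨_, _, h, _⟩ := H
  exact h

theorem Arrow.symm (H : Arrow a i g j) : Arrow a j g⁻¹ i := by
  obtain ⟨hi, hj, h, f, hf, hg⟩ := H
  exact ⟨hj, hi, h.symm, f, hf, by rw [← hg]; group⟩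

theorem exists_arrow (a : Vert n G) : ∃ i g j, Arrow a i g j := by
  obtain ⟨p, q, hne, hpq⟩ := Finset.card_eq_two.1 a.2.1
  obtain ⟨f, hf⟩ := Quotient.exists_rep a.1.cls
  exact ⟨p, _, q, by simp [hpq], by simp [hpq], hne, f, hf, rfl⟩

theorem Arrow.supp_eq (H : Arrow a i g j) : a.1.supp = {i, j} := by
  obtain ⟨hi, hj, h, _⟩ := H
  symm
  apply Finset.eq_of_subset_of_card_le
  · intro x hx
    simp only [Finset.mem_insert, Finset.mem_singleton] at hx
    rcases hx with rfl | rfl <;> assumption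
  · rw [a.2.1, Finset.card_pair h]

theorem Arrow.ends (H : Arrow a i g j) (H' : Arrow a k h l) :
    (i = k ∧ j = l) ∨ (i = l ∧ j = k) := by
  have h₁ := H.supp_eq
  have h₂ := H.ne
  have h₃ := H'.supp_eq
  have hi : i ∈ ({k, l} : Finset (Fin n)) := by rw [← h₃, h₁]; simp
  have hj : j ∈ ({k, l} : Finset (Fin n)) := by rw [← h₃, h₁]; simp
  simp only [Finset.mem_insert, Finset.mem_singleton] at hi hj
  grind

theorem Arrow.label_unique (H : Arrow a i g j) (H' : Arrow a i h j) : g = h := by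
  obtain ⟨hi, hj, -, f, hf, rfl⟩ := H
  obtain ⟨_, _, -, f', hf', rfl⟩ := H'
  obtain ⟨c, hc⟩ := Quotient.exact (hf.trans hf'.symm) a.1.supp (by simp [a.2.2])
  rw [hc _ hi, hc _ hj]
  group

/-- An arrow of `a` is one of two mutually inverse arrows. -/
theorem Arrow.cases (H : Arrow a i g j) (H' : Arrow a k h l) :
    (i = k ∧ j = l ∧ g = h) ∨ (i = l ∧ j = k ∧ g = h⁻¹) := by
  rcases H.ends H' with ⟨rfl, rfl⟩ | ⟨rfl, rfl⟩
  · exact .inl ⟨rfl, rfl, H.label_unique H'⟩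
  · exact .inr ⟨rfl, rfl, H.label_unique H'.symm⟩

theorem arrow_of_mem_supp (hi : i ∈ a.1.supp) (hj : j ∈ a.1.supp) (h : i ≠ j) :
    ∃ g, Arrow a i g j := by
  obtain ⟨f, hf⟩ := Quotient.exists_rep a.1.cls
  exact ⟨_, hi, hj, h, f, hf, rfl⟩

/-- Since π has a single block {i, j}, the class of f is determined by f(i)⁻¹ f(j); the left
translation constant is f(i) f'(i)⁻¹. -/
theorem Arrow.eq (H : Arrow a i g j) (H' : Arrow b i g j) : a = b := by
  have hs := H.supp_eq.trans H'.supp_eq.symm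
  have hsupp := H.supp_eq
  obtain ⟨⟨s, π, c⟩, h₁, h₂⟩ := a
  obtain ⟨⟨s', π', c'⟩, h₁', h₂'⟩ := b
  dsimp only at hs hsupp h₁ h₂ h₁' h₂'
  subst hs
  obtain rfl : π = π' := Finpartition.ext (h₂.trans h₂'.symm)
  obtain ⟨hi, hj, hne, f, hf, hg⟩ := H
  obtain ⟨hi', hj', -, f', hf', hg'⟩ := H'
  dsimp only at f f' hf hf'
  congr 2
  rw [← hf, ← hf']
  refine Quotient.sound fun B hB => ⟨f ⟨i, hi⟩ * (f' ⟨i, hi⟩)⁻¹, ?_⟩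
  rintro ⟨x, hx⟩ -
  have hx' : x = i ∨ x = j := by simpa [hsupp] using hx
  rcases hx' with rfl | rfl
  · group
  · rw [mul_assoc, hg', ← hg, mul_inv_cancel_left]

theorem exists_vert (h : i ≠ j) (g : G) : ∃ a : Vert n G, Arrow a i g j := by
  have hne : ({i, j} : Finset (Fin n)) ≠ ∅ := by simp
  refine ⟨⟨⟨{i, j}, Finpartition.indiscrete hne, Quotient.mk _ fun x => if x = i then 1 else g⟩,
    Finset.card_pair h, rfl⟩, by simp, by simp, h, _, rfl, ?_⟩
  simp [h.symm]

instance [Finite G] : Finite (Vert n G) := by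
  choose i g j h using exists_arrow (n := n) (G := G)
  refine Finite.of_injective (fun a => (i a, g a, j a)) fun a b hab => ?_
  simp only [Prod.mk.injEq] at hab
  obtain ⟨h₁, h₂, h₃⟩ := hab
  have := h b
  rw [← h₁, ← h₂, ← h₃] at this
  exact (h a).eq this

end Arrows

/-! ### Labelled walks, linkage classes and potentials -/

section LabelledWalks

variable {n : ℕ} {G : Type*} [Group G] {Z W : Set (Vert n G)} {a p : Vert n G}
  {i j k x y u v : Fin n} {g h : G}

theorem LabelledWalk.single (ha : a ∈ Z) (h : Arrow a i g j) : LabelledWalk Z i g j := by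
  simpa using LabelledWalk.cons a ha h (.nil j)

theorem LabelledWalk.append (w : LabelledWalk Z i g j) (w' : LabelledWalk Z j h k) :
    LabelledWalk Z i (g * h) k := by
  induction w with
  | nil => simpa using w'
  | cons a ha hg _ ih => simpa [mul_assoc] using LabelledWalk.cons a ha hg (ih w')

theorem LabelledWalk.symm (w : LabelledWalk Z i g j) : LabelledWalk Z j g⁻¹ i := by
  induction w with
  | nil => simpa using LabelledWalk.nil _
  | cons a ha hg _ ih => simpa using ih.append (.single ha hg.symm)

/-- If the arrows of `Z` can be replaced by walks in `W` then so can all walks. -/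
theorem LabelledWalk.lift
    (H : ∀ a ∈ Z, ∀ i g j, Arrow a i g j → LabelledWalk W i g j) (w : LabelledWalk Z i g j) :
    LabelledWalk W i g j := by
  induction w with
  | nil => exact .nil _
  | cons a ha hg _ ih => exact (H a ha _ _ _ hg).append ih

theorem LabelledWalk.mono (H : Z ⊆ W) (w : LabelledWalk Z i g j) : LabelledWalk W i g j :=
  w.lift fun _ ha _ _ _ h => .single (H ha) h

theorem IsGTrivial.anti (H : Z ⊆ W) (h : IsGTrivial W) : IsGTrivial Z :=
  fun i g w => h i g (w.mono H)

theorem IsGTrivial.label_unique (H : IsGTrivial Z) (w : LabelledWalk Z i g j)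
    (w' : LabelledWalk Z i h j) : g = h :=
  mul_inv_eq_one.1 (H _ _ (w.append w'.symm))

/-- Two elements of `Fin n` are linked by `Z` if there is a walk between them in `Γ(Z)`. -/
def Linked (Z : Set (Vert n G)) (i j : Fin n) : Prop := ∃ g, LabelledWalk Z i g j

theorem Linked.refl (i : Fin n) : Linked Z i i := ⟨1, .nil i⟩

theorem Linked.symm (h : Linked Z i j) : Linked Z j i := ⟨_, h.choose_spec.symm⟩

theorem Linked.trans (h : Linked Z i j) (h' : Linked Z j k) : Linked Z i k :=
  ⟨_, h.choose_spec.append h'.choose_spec⟩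

theorem Arrow.linked (h : Arrow a i g j) (ha : a ∈ Z) : Linked Z i j := ⟨g, .single ha h⟩

theorem Linked.lift (H : ∀ a ∈ Z, ∀ i g j, Arrow a i g j → Linked W i j) (h : Linked Z i j) :
    Linked W i j := by
  obtain ⟨g, w⟩ := h
  induction w with
  | nil => exact .refl _
  | cons a ha hg _ ih => exact (H a ha _ _ _ hg).trans ih

theorem Linked.mono (H : Z ⊆ W) (h : Linked Z i j) : Linked W i j :=
  h.lift fun _ ha _ _ _ h => h.linked (H ha)

theorem linked_empty_iff : Linked (∅ : Set (Vert n G)) i j ↔ i = j := by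
  refine ⟨fun ⟨g, w⟩ => ?_, fun h => h ▸ .refl _⟩
  cases w with
  | nil => rfl
  | cons a ha => exact ha.elim

/-- For mere linkage, a walk never needs to traverse `p` more than once. -/
theorem linked_insert_iff (hp : Arrow p u g v) :
    Linked (insert p Z) x y ↔
      Linked Z x y ∨ (Linked Z x u ∧ Linked Z v y) ∨ (Linked Z x v ∧ Linked Z u y) := by
  constructor
  · rintro ⟨h, w⟩
    induction w with
    | nil => exact .inl (.refl _)
    | cons a ha hg _ ih =>
      rcases ha with rfl | ha
      · rcases hg.ends hp with ⟨rfl, rfl⟩ | ⟨rfl, rfl⟩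
        · rcases ih with h | ⟨h₁, h₂⟩ | ⟨h₁, h₂⟩
          · exact .inr (.inl ⟨.refl _, h⟩)
          · exact .inr (.inl ⟨.refl _, h₂⟩)
          · exact .inl h₂
        · rcases ih with h | ⟨h₁, h₂⟩ | ⟨h₁, h₂⟩
          · exact .inr (.inr ⟨.refl _, h⟩)
          · exact .inl h₂
          · exact .inr (.inr ⟨.refl _, h₂⟩)
      · have := hg.linked ha
        rcases ih with h | ⟨h₁, h₂⟩ | ⟨h₁, h₂⟩
        · exact .inl (this.trans h)
        · exact .inr (.inl ⟨this.trans h₁, h₂⟩)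
        · exact .inr (.inr ⟨this.trans h₁, h₂⟩)
  · have hm : Z ⊆ insert p Z := Set.subset_insert p Z
    have hl : Linked (insert p Z) u v := hp.linked (Set.mem_insert p Z)
    rintro (h | ⟨h₁, h₂⟩ | ⟨h₁, h₂⟩)
    · exact h.mono hm
    · exact ((h₁.mono hm).trans hl).trans (h₂.mono hm)
    · exact ((h₁.mono hm).trans hl.symm).trans (h₂.mono hm)

/-- The equivalence relation of being linked by `Z`. -/
def linkSetoid (Z : Set (Vert n G)) : Setoid (Fin n) where
  r := Linked Z
  iseqv := ⟨Linked.refl, Linked.symm, Linked.trans⟩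

/-- The number of classes of elements of `Fin n` linked by `Z`. -/
noncomputable def numClasses (Z : Set (Vert n G)) : ℕ := Nat.card (Quotient (linkSetoid Z))

theorem numClasses_empty : numClasses (∅ : Set (Vert n G)) = n := by
  have : Function.Bijective (Quotient.mk (linkSetoid (∅ : Set (Vert n G)))) :=
    ⟨fun _ _ h => linked_empty_iff.1 (Quotient.exact h), Quotient.mk_surjective⟩
  rw [numClasses, ← Nat.card_congr (Equiv.ofBijective _ this), Nat.card_fin]

theorem numClasses_congr (H : ∀ i j, Linked Z i j ↔ Linked W i j) :
    numClasses Z = numClasses W := by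
  have : linkSetoid Z = linkSetoid W := Setoid.ext H
  rw [numClasses, this, numClasses]

theorem numClasses_insert_of_linked (hp : Arrow p u g v) (H : Linked Z u v) :
    numClasses (insert p Z) = numClasses Z := by
  refine numClasses_congr fun i j => ?_
  rw [linked_insert_iff hp]
  refine ⟨?_, .inl⟩
  rintro (h | ⟨h₁, h₂⟩ | ⟨h₁, h₂⟩)
  · exact h
  · exact (h₁.trans H).trans h₂
  · exact (h₁.trans H.symm).trans h₂

/-- The new edge only merges the classes of `u` and `v`, so the old classes other than that of `v`
correspond bijectively to the new ones. -/
theorem numClasses_insert_of_not_linked (hp : Arrow p u g v) (H : ¬ Linked Z u v) :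
    numClasses (insert p Z) + 1 = numClasses Z := by
  let φ : Quotient (linkSetoid Z) → Quotient (linkSetoid (insert p Z)) :=
    Quotient.map' id fun _ _ h => Linked.mono (Set.subset_insert p Z) h
  have hφ : Function.Bijective fun q : {q // q ≠ Quotient.mk (linkSetoid Z) v} => φ q := by
    constructor
    · rintro ⟨q, hq⟩ ⟨r, hr⟩ h
      induction q using Quotient.inductionOn with | _ x
      induction r using Quotient.inductionOn with | _ y
      have hx : ¬ Linked Z x v := fun h => hq (Quotient.sound h)
      have hy : ¬ Linked Z y v := fun h => hr (Quotient.sound h)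
      have h' : Linked (insert p Z) x y := Quotient.exact h
      rcases (linked_insert_iff hp).1 h' with h | ⟨_, h⟩ | ⟨h, _⟩
      · exact Subtype.ext (Quotient.sound h)
      · exact (hy h.symm).elim
      · exact (hx h).elim
    · intro q
      induction q using Quotient.inductionOn with | _ x
      by_cases hx : Linked Z x v
      · refine ⟨⟨Quotient.mk _ u, fun h => H (Quotient.exact h)⟩, Quotient.sound ?_⟩
        exact (linked_insert_iff hp).2 (.inr (.inl ⟨.refl _, hx.symm⟩))
      · exact ⟨⟨Quotient.mk _ x, fun h => hx (Quotient.exact h)⟩, rfl⟩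
  rw [numClasses, ← Nat.card_congr (Equiv.ofBijective _ hφ), numClasses]
  have := Set.ncard_sdiff_singleton_add_one (Set.mem_univ (Quotient.mk (linkSetoid Z) v))
  rw [Set.ncard_univ] at this
  rw [← this, ← Nat.card_coe_set_eq]
  congr 2
  apply congrArg
  ext
  simp

/-- A `G`-trivial labelled graph has a potential. -/
theorem IsGTrivial.exists_potential (H : IsGTrivial Z) :
    ∃ φ : Fin n → G, ∀ i g j, LabelledWalk Z i g j → g = (φ i)⁻¹ * φ j := by
  -- The potential of `i` is the label of a walk to `i` from the chosen representative of its class.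
  have key : ∀ i, ∃ g, LabelledWalk Z (Quotient.mk (linkSetoid Z) i).out g i := fun i =>
    Quotient.exact (Quotient.out_eq (Quotient.mk (linkSetoid Z) i))
  choose φ hφ using key
  refine ⟨φ, fun i g j w => ?_⟩
  have hij : Quotient.mk (linkSetoid Z) i = Quotient.mk (linkSetoid Z) j := Quotient.sound ⟨g, w⟩
  have h := hφ i
  rw [hij] at h
  rw [eq_inv_mul_iff_mul_eq]
  exact H.label_unique (h.append w) (hφ j)

theorem isGTrivial_of_potential (φ : Fin n → G)
    (H : ∀ a ∈ Z, ∀ i g j, Arrow a i g j → g = (φ i)⁻¹ * φ j) : IsGTrivial Z := by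
  have : ∀ i g j, LabelledWalk Z i g j → g = (φ i)⁻¹ * φ j := by
    intro i g j w
    induction w with
    | nil => simp
    | cons a ha hg _ ih => rw [ih, H a ha _ _ _ hg]; group
  intro i g w
  simpa using this i g i w

/-- Left translation of a potential on the whole class of `v` preserves the labels of `Z`. As `u`
lies outside that class, the constant can be chosen to give `p` its label. -/
theorem IsGTrivial.insert_of_not_linked (H : IsGTrivial Z) (hp : Arrow p u g v)
    (hl : ¬ Linked Z u v) : IsGTrivial (insert p Z) := by
  classical
  obtain ⟨φ, hφ⟩ := H.exists_potential
  let ψ : Fin n → G := fun x => if Linked Z x v then φ u * g * (φ v)⁻¹ * φ x else φ x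
  have hu : ψ u = φ u := if_neg hl
  have hv : ψ v = φ u * g := by simp [ψ, Linked.refl]
  refine isGTrivial_of_potential ψ ?_
  rintro a (rfl | ha) i h j hij
  · rcases hij.cases hp with ⟨rfl, rfl, rfl⟩ | ⟨rfl, rfl, rfl⟩
    · rw [hu, hv]; group
    · rw [hu, hv]; group
  · have hiff : Linked Z i v ↔ Linked Z j v :=
      ⟨(hij.linked ha).symm.trans, (hij.linked ha).trans⟩
    rw [hφ i h j (.single ha hij)]
    by_cases hc : Linked Z j v
    · simp only [ψ, hiff, hc, if_true]; group
    · simp only [ψ, hiff, hc, if_false]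

end LabelledWalks

/-! ### Cycles and the cyclomatic number -/

section Counting

variable {n : ℕ} {G : Type*} [Group G] {Z W : Set (Vert n G)} {a p : Vert n G}
  {i j k x y u v : Fin n} {g h : G}

/-- `Γ₀(Z)` has no nonempty closed trail. -/
def Acyclic (Z : Set (Vert n G)) : Prop :=
  ∀ x l, IsWalk (undirected Z) x l x → l.Nodup → l = []

theorem IsWalk.linked {l : List (Vert n G)} (w : IsWalk (undirected W) x l y)
    (H : ∀ e ∈ l, e ∈ Z) : Linked Z x y := by
  induction w with
  | nil => exact .refl _
  | cons h _ ih =>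
    obtain ⟨_, _, h⟩ := h
    simp only [List.mem_cons, forall_eq_or_imp] at H
    exact (h.linked H.1).trans (ih H.2)

theorem IsWalk.mem {l : List (Vert n G)} (w : IsWalk (undirected W) x l y) :
    ∀ e ∈ l, e ∈ W := by
  induction w with
  | nil => simp
  | cons h _ ih =>
    simp only [List.mem_cons, forall_eq_or_imp]
    exact ⟨h.1, ih⟩

theorem IsWalk.transfer {l : List (Vert n G)} (w : IsWalk (undirected W) x l y)
    (hx : x ∈ (undirected Z).vertexSet) (H : ∀ e ∈ l, e ∈ Z) : IsWalk (undirected Z) x l y := by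
  induction w with
  | nil => exact .nil _ hx
  | cons h _ ih =>
    obtain ⟨_, h⟩ := h
    simp only [List.mem_cons, forall_eq_or_imp] at H
    have hl : (undirected Z).IsLink _ _ _ := ⟨H.1, h⟩
    exact .cons hl (ih hl.right_mem H.2)

/-- The hypothesis is needed because `Linked` is reflexive on all of `Fin n`, whereas Γ₀(Z) has no
isolated vertices. -/
theorem exists_isWalk_iff (hx : x ∈ (undirected Z).vertexSet) :
    (∃ l, IsWalk (undirected Z) x l y) ↔ Linked Z x y := by
  constructor
  · rintro ⟨l, w⟩
    exact w.linked w.mem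
  · rintro ⟨g, w⟩
    induction w with
    | nil => exact ⟨[], .nil _ hx⟩
    | cons a ha hg _ ih =>
      have hl : (undirected Z).IsLink a _ _ := ⟨ha, _, hg⟩
      obtain ⟨l, w⟩ := ih hl.right_mem
      exact ⟨a :: l, .cons hl w⟩

theorem Linked.exists_trail (hx : x ∈ (undirected Z).vertexSet) (h : Linked Z x y) :
    ∃ l, l.Nodup ∧ IsWalk (undirected Z) x l y := by
  obtain ⟨l, w⟩ := (exists_isWalk_iff hx).2 h
  obtain ⟨l', hn, -, w'⟩ := w.exists_nodup
  exact ⟨l', hn, w'⟩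

theorem acyclic_empty : Acyclic (∅ : Set (Vert n G)) := fun _ _ w _ =>
  List.eq_nil_iff_forall_not_mem.2 fun e he => w.mem e he

theorem vertexSet_mono (H : Z ⊆ W) : (undirected Z).vertexSet ⊆ (undirected W).vertexSet :=
  fun _ ⟨a, ha, h⟩ => ⟨a, H ha, h⟩

theorem acyclic_insert_iff (hp : Arrow p u g v) (hpZ : p ∉ Z) :
    Acyclic (insert p Z) ↔ Acyclic Z ∧ ¬ Linked Z u v := by
  have hm : Z ⊆ insert p Z := Set.subset_insert p Z
  constructor
  · refine fun H => ⟨fun x l w hn => ?_, fun hl => ?_⟩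
    · exact H x l (w.transfer (vertexSet_mono hm w.left_mem) fun e he => hm (w.mem e he)) hn
    · have hu : u ∈ (undirected Z).vertexSet := by
        obtain ⟨g, w⟩ := hl
        cases w with
        | nil => exact (hp.ne rfl).elim
        | cons a ha hg _ => exact ⟨a, ha, hg.1⟩
      obtain ⟨l, hn, w⟩ := hl.exists_trail hu
      have hlink : (undirected (insert p Z)).IsLink p v u := ⟨Set.mem_insert p Z, _, hp.symm⟩
      have := H v (p :: l) (.cons hlink
        (w.transfer (vertexSet_mono hm hu) fun e he => hm (w.mem e he)))
        (List.nodup_cons.2 ⟨fun h => hpZ (w.mem p h), hn⟩)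
      simp at this
  · rintro ⟨H, hl⟩ x l w hn
    by_cases hpl : p ∈ l
    · obtain ⟨l₁, l₂, rfl⟩ := List.append_of_mem hpl
      obtain ⟨y, w₁, w₂⟩ := w.split
      have h₁ : ∀ e ∈ l₁, e ∈ Z := fun e he =>
        (w₁.mem e he).resolve_left fun h => by
          subst h; exact (List.nodup_append.1 hn).2.2 e he e (by simp) rfl
      cases w₂ with
      | cons h w₂ =>
        have h₂ : ∀ e ∈ l₂, e ∈ Z := fun e he =>
          (w₂.mem e he).resolve_left fun h => by
            subst h; exact (List.nodup_cons.1 (List.nodup_append.1 hn).2.1).1 he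
        obtain ⟨_, g', h⟩ := h
        -- A trail uses `p` only once, so the rest of the closed trail joins the ends of `p` inside
        -- `Z`.
        have := (w₂.linked h₂).trans (w₁.linked h₁)
        rcases h.ends hp with ⟨rfl, rfl⟩ | ⟨rfl, rfl⟩
        · exact (hl this.symm).elim
        · exact (hl this).elim
    · have hZ : ∀ e ∈ l, e ∈ Z := fun e he =>
        (w.mem e he).resolve_left fun h => hpl (h ▸ he)
      cases w with
      | nil => rfl
      | @cons _ y _ e l' h w =>
        have hx : x ∈ (undirected Z).vertexSet := ⟨e, hZ e (by simp), h.2.choose_spec.1⟩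
        exact H x _ ((IsWalk.cons h w).transfer hx hZ) hn

/-- The cyclomatic number of a multigraph is nonnegative, and it is zero if and only if there are
no cycles. -/
theorem le_ncard_add_numClasses [Finite G] (Z : Set (Vert n G)) :
    n ≤ Z.ncard + numClasses Z ∧ (n = Z.ncard + numClasses Z ↔ Acyclic Z) := by
  induction Z, Z.toFinite using Set.Finite.induction_on with
  | empty => simp [numClasses_empty, acyclic_empty]
  | @insert p Z hpZ hZ ih =>
    obtain ⟨u, g, v, hp⟩ := exists_arrow p
    rw [acyclic_insert_iff hp hpZ, Set.ncard_insert_of_notMem hpZ hZ, ← ih.2]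
    by_cases hl : Linked Z u v
    · rw [numClasses_insert_of_linked hp hl]
      simp only [hl, not_true, and_false, iff_false]
      omega
    · have := numClasses_insert_of_not_linked hp hl
      simp only [hl, not_false_eq_true, and_true]
      omega

end Counting

/-! ### Components, and the rank description of faces -/

section Components

variable {n : ℕ} {G : Type*} [Group G] {Z W : Set (Vert n G)} {a p : Vert n G}
  {i j k x y u v : Fin n} {g h : G}

/-- The elements of `Fin n` linked to `x`. -/
def linkClass (Z : Set (Vert n G)) (x : Fin n) : Set (Fin n) := {y | Linked Z x y}

/-- The edges of `Γ₀(Z)` in the class of `x`. -/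
def classEdges (Z : Set (Vert n G)) (x : Fin n) : Set (Vert n G) :=
  {a | a ∈ Z ∧ ∀ i ∈ a.1.supp, Linked Z x i}

theorem Arrow.mem_classEdges_iff (h : Arrow a i g j) (ha : a ∈ Z) :
    a ∈ classEdges Z x ↔ Linked Z x i := by
  refine ⟨fun H => H.2 i h.1, fun H => ⟨ha, fun k hk => ?_⟩⟩
  rw [h.supp_eq, Finset.mem_insert, Finset.mem_singleton] at hk
  rcases hk with rfl | rfl
  · exact H
  · exact H.trans (h.linked ha)

theorem isComponent_iff {C : Set (Fin n)} :
    IsComponent (undirected Z) C ↔ ∃ x ∈ (undirected Z).vertexSet, C = linkClass Z x := by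
  refine exists_congr fun x => and_congr_right fun hx => ?_
  rw [linkClass]
  simp only [exists_isWalk_iff hx]

theorem exists_arrow_of_mem_vertexSet (hx : x ∈ (undirected Z).vertexSet) :
    ∃ a ∈ Z, ∃ g y, Arrow a x g y := by
  obtain ⟨a, ha, hxa⟩ := hx
  obtain ⟨u, g, v, h⟩ := exists_arrow a
  rw [h.supp_eq, Finset.mem_insert, Finset.mem_singleton] at hxa
  rcases hxa with rfl | rfl
  · exact ⟨a, ha, g, v, h⟩
  · exact ⟨a, ha, _, u, h.symm⟩

theorem Linked.mem_vertexSet (h : Linked Z x y) (hx : x ∈ (undirected Z).vertexSet) :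
    y ∈ (undirected Z).vertexSet := by
  obtain ⟨g, w⟩ := h
  induction w with
  | nil => exact hx
  | cons a ha hg _ ih => exact ih ⟨a, ha, hg.2.1⟩

/-- This puts a component in the form `undirected _`, so that `le_ncard_add_numClasses` applies to
it. -/
theorem induce_linkClass (hx : x ∈ (undirected Z).vertexSet) :
    (undirected Z).induce (linkClass Z x) = undirected (classEdges Z x) := by
  apply Graph.ext
  · ext y
    constructor
    · intro hy
      have hy' : Linked Z x y := hy
      obtain ⟨a, ha, g, z, h⟩ := exists_arrow_of_mem_vertexSet (hy'.mem_vertexSet hx)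
      exact ⟨a, (h.mem_classEdges_iff ha).2 hy', h.1⟩
    · rintro ⟨a, ha, hya⟩
      exact ha.2 y hya
  · intro e y z
    constructor
    · rintro ⟨⟨he, g, h⟩, hy, -⟩
      exact ⟨(h.mem_classEdges_iff he).2 hy, g, h⟩
    · rintro ⟨he, g, h⟩
      exact ⟨⟨he.1, g, h⟩, he.2 y h.1, he.2 z h.2.1⟩

theorem linked_classEdges_of_linked (h : Linked Z x y) : Linked (classEdges Z x) x y := by
  have key : ∀ z g y, LabelledWalk Z z g y → Linked Z x z → Linked (classEdges Z x) z y := by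
    intro z g y w
    induction w with
    | nil => exact fun _ => .refl _
    | cons a ha hg _ ih =>
      exact fun hz => (hg.linked ((hg.mem_classEdges_iff ha).2 hz)).trans
        (ih (hz.trans (hg.linked ha)))
  exact key x _ y h.choose_spec (.refl x)

theorem linked_classEdges_iff :
    Linked (classEdges Z x) y z ↔ y = z ∨ (Linked Z x y ∧ Linked Z x z) := by
  constructor
  · rintro ⟨g, w⟩
    induction w with
    | nil => exact .inl rfl
    | cons a ha hg _ ih =>
      refine .inr ⟨ha.2 _ hg.1, ?_⟩
      rcases ih with rfl | h
      · exact ha.2 _ hg.2.1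
      · exact h.2
  · rintro (rfl | ⟨h₁, h₂⟩)
    · exact .refl _
    · exact (linked_classEdges_of_linked h₁).symm.trans (linked_classEdges_of_linked h₂)

/-- With only these edges kept, every point outside the class of `x` becomes a singleton class;
`none` below stands for the class of `x`. -/
theorem numClasses_classEdges (Z : Set (Vert n G)) (x : Fin n) :
    numClasses (classEdges Z x) + (linkClass Z x).ncard = n + 1 := by
  classical
  let φ : Option ((linkClass Z x)ᶜ : Set (Fin n)) → Quotient (linkSetoid (classEdges Z x)) :=
    fun o => o.elim (Quotient.mk _ x) fun y => Quotient.mk _ (y : Fin n)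
  have hφ : Function.Bijective φ := by
    constructor
    · rintro (_ | ⟨y, hy⟩) (_ | ⟨z, hz⟩) h
      · rfl
      · rcases linked_classEdges_iff.1 (Quotient.exact h) with rfl | h
        · exact (hz (.refl _)).elim
        · exact (hz h.2).elim
      · rcases linked_classEdges_iff.1 (Quotient.exact h) with h | h
        · exact (hy (h ▸ Linked.refl y)).elim
        · exact (hy h.1).elim
      · rcases linked_classEdges_iff.1 (Quotient.exact h) with h | h
        · exact congrArg some (Subtype.ext h)
        · exact (hy h.1).elim
    · intro q
      induction q using Quotient.inductionOn with | _ y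
      by_cases hy : Linked Z x y
      · exact ⟨none, Quotient.sound (linked_classEdges_iff.2 (.inr ⟨.refl _, hy⟩))⟩
      · exact ⟨some ⟨y, hy⟩, rfl⟩
  have h₁ := Set.ncard_add_ncard_compl (linkClass Z x)
  rw [Nat.card_fin] at h₁
  rw [numClasses, ← Nat.card_congr (Equiv.ofBijective φ hφ), Finite.card_option,
    Nat.card_coe_set_eq]
  omega

theorem isConnected_classEdges (hx : x ∈ (undirected Z).vertexSet) :
    IsConnected (undirected (classEdges Z x)) := by
  have hm : ∀ y ∈ (undirected (classEdges Z x)).vertexSet, Linked Z x y := by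
    rintro y ⟨a, ha, h⟩
    exact ha.2 y h
  refine ⟨?_, fun y hy z hz => ?_⟩
  · obtain ⟨a, ha, g, y, h⟩ := exists_arrow_of_mem_vertexSet hx
    exact ⟨x, a, (h.mem_classEdges_iff ha).2 (.refl x), h.1⟩
  · exact (exists_isWalk_iff hy).2 (linked_classEdges_iff.2 (.inr ⟨hm y hy, hm z hz⟩))

theorem ncard_linkClass_le [Finite G] (Z : Set (Vert n G)) (x : Fin n) :
    (linkClass Z x).ncard ≤ (classEdges Z x).ncard + 1 := by
  have := (le_ncard_add_numClasses (classEdges Z x)).1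
  have := numClasses_classEdges Z x
  omega

theorem isTree_induce_iff [Finite G] (hx : x ∈ (undirected Z).vertexSet) :
    IsTree ((undirected Z).induce (linkClass Z x)) ↔
      (classEdges Z x).ncard + 1 = (linkClass Z x).ncard := by
  rw [induce_linkClass hx, IsTree]
  have h₁ := (le_ncard_add_numClasses (classEdges Z x)).2
  have h₂ := numClasses_classEdges Z x
  have h₃ := isConnected_classEdges hx
  rw [← Acyclic, ← h₁]
  simp only [h₃, true_and]
  omega

theorem isUnicyclic_induce_iff [Finite G] (hx : x ∈ (undirected Z).vertexSet) :
    IsUnicyclic ((undirected Z).induce (linkClass Z x)) ↔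
      (classEdges Z x).ncard = (linkClass Z x).ncard := by
  have hV : (undirected (classEdges Z x)).vertexSet = linkClass Z x := by
    rw [← induce_linkClass hx]; rfl
  have hconn := isConnected_classEdges hx
  rw [induce_linkClass hx, IsUnicyclic, hV]
  have hloop : ∀ e y, ¬ (undirected (classEdges Z x)).IsLoopAt e y :=
    fun e y ⟨_, _, h⟩ => h.ne rfl
  simp only [hconn, hloop, true_and, not_false_eq_true, implies_true]
  rw [show (undirected (classEdges Z x)).edgeSet = classEdges Z x from rfl,
    ← (Set.toFinite (linkClass Z x)).cast_ncard_eq,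
    ← (Set.toFinite (classEdges Z x)).cast_ncard_eq, Nat.cast_inj, eq_comm]

/-- The cyclomatic number of the class of `x`. -/
noncomputable def classDefect (Z : Set (Vert n G)) (x : Fin n) : ℕ :=
  (classEdges Z x).ncard + 1 - (linkClass Z x).ncard

theorem linkClass_congr (h : Linked Z x y) : linkClass Z x = linkClass Z y :=
  Set.ext fun _ => ⟨h.symm.trans, h.trans⟩

theorem classEdges_congr (h : Linked Z x y) : classEdges Z x = classEdges Z y :=
  Set.ext fun _ => and_congr_right fun _ => forall₂_congr fun _ _ => ⟨h.symm.trans, h.trans⟩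

theorem sum_classDefect [Finite G] (Z : Set (Vert n G)) [Fintype (Quotient (linkSetoid Z))] :
    ∑ q : Quotient (linkSetoid Z), classDefect Z q.out + n = Z.ncard + numClasses Z := by
  classical
  have := Fintype.ofFinite (Vert n G)
  have hn : ∑ q : Quotient (linkSetoid Z), (linkClass Z q.out).ncard = n := by
    have := Finset.card_eq_sum_card_fiberwise (s := (Finset.univ : Finset (Fin n)))
      (t := Finset.univ) (f := Quotient.mk (linkSetoid Z)) (fun _ _ => Finset.mem_univ _)
    rw [Finset.card_fin] at this
    refine Eq.trans ?_ this.symm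
    refine Finset.sum_congr rfl fun q _ => ?_
    rw [← Set.ncard_coe_finset]
    congr 1
    ext y
    have : Quotient.mk (linkSetoid Z) y = q ↔ Linked Z q.out y := by
      conv_lhs => rw [← Quotient.out_eq q, eq_comm]
      exact Quotient.eq
    simp [linkClass, this]
  have hZ : ∑ q : Quotient (linkSetoid Z), (classEdges Z q.out).ncard = Z.ncard := by
    choose u g v h using exists_arrow (n := n) (G := G)
    have := Finset.card_eq_sum_card_fiberwise (s := Z.toFinset)
      (t := Finset.univ) (f := fun a => Quotient.mk (linkSetoid Z) (u a))
      (fun _ _ => Finset.mem_univ _)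
    rw [Set.ncard_eq_toFinset_card', this]
    refine Finset.sum_congr rfl fun q _ => ?_
    rw [← Set.ncard_coe_finset]
    congr 1
    ext a
    have : Quotient.mk (linkSetoid Z) (u a) = q ↔ Linked Z q.out (u a) := by
      conv_lhs => rw [← Quotient.out_eq q, eq_comm]
      exact Quotient.eq
    simp only [Finset.coe_filter, Set.mem_toFinset, Set.mem_ofPred_eq, this]
    exact ⟨fun H => ⟨H.1, ((h a).mem_classEdges_iff H.1).1 H⟩,
      fun H => ((h a).mem_classEdges_iff H.1).2 H.2⟩
  -- The subtraction in `classDefect` is not truncated, since a connected graph has at most one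
  -- vertex more than edges.
  have hd : ∀ q : Quotient (linkSetoid Z), classDefect Z q.out + (linkClass Z q.out).ncard =
      (classEdges Z q.out).ncard + 1 := fun q => by
    have := ncard_linkClass_le Z q.out
    rw [classDefect]
    omega
  have := Finset.sum_congr rfl fun q (_ : q ∈ Finset.univ) => hd q
  rw [Finset.sum_add_distrib, Finset.sum_add_distrib, hn, hZ] at this
  rw [this, numClasses, Nat.card_eq_fintype_card]
  simp

open Classical in
/-- The excess: `1` for `G`-nontrivial sets and `0` for `G`-trivial sets. -/
noncomputable def excess (Z : Set (Vert n G)) : ℕ := if IsGTrivial Z then 0 else 1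

theorem excess_congr (h : IsGTrivial Z ↔ IsGTrivial W) : excess Z = excess W := by
  rw [excess, excess]
  split_ifs <;> tauto

theorem classDefect_eq_zero_of_notMem (hx : x ∉ (undirected Z).vertexSet) :
    classDefect Z x = 0 := by
  have h₁ : classEdges Z x = ∅ := by
    refine Set.eq_empty_of_forall_notMem fun a ha => hx ?_
    obtain ⟨u, g, v, h⟩ := exists_arrow a
    exact (ha.2 u h.1).symm.mem_vertexSet ⟨a, ha.1, h.1⟩
  have h₂ : 0 < (linkClass Z x).ncard := (Set.ncard_pos).2 ⟨x, .refl x⟩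
  rw [classDefect, h₁, Set.ncard_empty]
  omega

/-- The faces of the reduced Rhodes matroid are the sets whose size is at most
their rank. -/
theorem mem_rhodes_iff [Finite G] :
    Z ∈ rhodes n G ↔ Z.ncard + numClasses Z ≤ n + excess Z := by
  classical
  have : Fintype (Quotient (linkSetoid Z)) := Fintype.ofFinite _
  -- The claim is now that the defects sum to at most `excess Z`. Trees have defect 0, unicyclic
  -- components defect 1, and isolated points contribute 0.
  rw [← sum_classDefect, add_comm, Nat.add_le_add_iff_left]
  have htree : ∀ x ∈ (undirected Z).vertexSet,
      (IsTree ((undirected Z).induce (linkClass Z x)) ↔ classDefect Z x = 0) := fun x hx => by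
    have := ncard_linkClass_le Z x
    rw [isTree_induce_iff hx, classDefect]
    omega
  have huni : ∀ x ∈ (undirected Z).vertexSet,
      (IsUnicyclic ((undirected Z).induce (linkClass Z x)) ↔ classDefect Z x = 1) :=
    fun x hx => by
      have := ncard_linkClass_le Z x
      rw [isUnicyclic_induce_iff hx, classDefect]
      omega
  have hmem : ∀ x, classDefect Z x ≠ 0 → x ∈ (undirected Z).vertexSet := fun x h => by
    by_contra hx
    exact h (classDefect_eq_zero_of_notMem hx)
  have hcongr : ∀ x, classDefect Z (Quotient.mk (linkSetoid Z) x).out = classDefect Z x := by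
    intro x
    have : Linked Z (Quotient.mk (linkSetoid Z) x).out x :=
      Quotient.exact (Quotient.out_eq (Quotient.mk (linkSetoid Z) x))
    rw [classDefect, classDefect, linkClass_congr this, classEdges_congr this]
  constructor
  · rintro ⟨h₁, h₂, h₃⟩
    by_cases h : ∃ q : Quotient (linkSetoid Z), classDefect Z q.out ≠ 0
    · obtain ⟨q, hq⟩ := h
      have hone : ∀ r : Quotient (linkSetoid Z), classDefect Z r.out ≠ 0 →
          classDefect Z r.out = 1 := fun r hr => by
        have hx := hmem _ hr
        rcases h₁ _ (isComponent_iff.2 ⟨_, hx, rfl⟩) with h | h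
        · exact (hr ((htree _ hx).1 h)).elim
        · exact (huni _ hx).1 h
      have hsum : ∑ r : Quotient (linkSetoid Z), classDefect Z r.out = classDefect Z q.out := by
        refine Finset.sum_eq_single q (fun r _ hrq => ?_) (by simp)
        by_contra hr
        have := h₂ _ _ (isComponent_iff.2 ⟨_, hmem _ hr, rfl⟩)
          (isComponent_iff.2 ⟨_, hmem _ hq, rfl⟩) ((huni _ (hmem _ hr)).2 (hone r hr))
          ((huni _ (hmem _ hq)).2 (hone q hq))
        have hl : q.out ∈ linkClass Z r.out := this ▸ Linked.refl _
        apply hrq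
        rw [← Quotient.out_eq r, ← Quotient.out_eq q]
        exact Quotient.sound hl
      have := h₃ ⟨_, isComponent_iff.2 ⟨_, hmem _ hq, rfl⟩,
        (huni _ (hmem _ hq)).2 (hone q hq)⟩
      rw [hsum, hone q hq, excess, if_neg this]
    · push Not at h
      simp [h]
  · intro H
    have hle : ∀ x, classDefect Z x ≤ excess Z := fun x => by
      rw [← hcongr]
      exact (Finset.single_le_sum (f := fun q : Quotient (linkSetoid Z) => classDefect Z q.out)
        (fun _ _ => Nat.zero_le _) (Finset.mem_univ _)).trans H
    have hexc : excess Z ≤ 1 := by rw [excess]; split_ifs <;> omega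
    refine ⟨fun C hC => ?_, fun C D hC hD hC' hD' => ?_, ?_⟩
    · obtain ⟨x, hx, rfl⟩ := isComponent_iff.1 hC
      rw [htree x hx, huni x hx]
      have := hle x
      omega
    · obtain ⟨x, hx, rfl⟩ := isComponent_iff.1 hC
      obtain ⟨y, hy, rfl⟩ := isComponent_iff.1 hD
      rw [huni x hx, ← hcongr] at hC'
      rw [huni y hy, ← hcongr] at hD'
      by_contra hne
      have hxy : Quotient.mk (linkSetoid Z) x ≠ Quotient.mk (linkSetoid Z) y := fun h =>
        hne (linkClass_congr (Quotient.exact h))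
      have := Finset.sum_le_sum_of_subset (f := fun q => classDefect Z q.out)
        (Finset.subset_univ {Quotient.mk (linkSetoid Z) x, Quotient.mk (linkSetoid Z) y})
      rw [Finset.sum_pair hxy] at this
      omega
    · rintro ⟨C, hC, hu⟩ ht
      obtain ⟨x, hx, rfl⟩ := isComponent_iff.1 hC
      have h₁ := (huni x hx).1 hu
      have h₂ := hle x
      rw [excess, if_pos ht] at h₂
      omega

end Components

/-! ### Closure, rank and the truncation T(H_k) -/

section Closure

variable {n : ℕ} {G : Type*} [Group G] {Z W T : Set (Vert n G)} {a b c e p q : Vert n G}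
  {i j k l x y u v : Fin n} {g h : G}

/-- The closure operator of the reduced Rhodes matroid. -/
def cl (Z : Set (Vert n G)) : Set (Vert n G) :=
  {p | ∃ i g j, Arrow p i g j ∧ Linked Z i j ∧ (IsGTrivial Z → LabelledWalk Z i g j)}

theorem Arrow.mem_cl_iff (hp : Arrow p u g v) :
    p ∈ cl Z ↔ Linked Z u v ∧ (IsGTrivial Z → LabelledWalk Z u g v) := by
  refine ⟨?_, fun h => ⟨u, g, v, hp, h⟩⟩
  rintro ⟨i, h, j, hij, hl, hw⟩
  rcases hij.cases hp with ⟨rfl, rfl, rfl⟩ | ⟨rfl, rfl, rfl⟩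
  · exact ⟨hl, hw⟩
  · exact ⟨hl.symm, fun ht => by simpa using (hw ht).symm⟩

theorem subset_cl : Z ⊆ cl Z := fun p hp => by
  obtain ⟨u, g, v, h⟩ := exists_arrow p
  exact h.mem_cl_iff.2 ⟨h.linked hp, fun _ => .single hp h⟩

theorem cl_mono (H : Z ⊆ W) : cl Z ⊆ cl W := by
  rintro p ⟨i, g, j, hp, hl, hw⟩
  exact ⟨i, g, j, hp, hl.mono H, fun ht => (hw (ht.anti H)).mono H⟩

theorem cl_cl (Z : Set (Vert n G)) : cl (cl Z) = cl Z := by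
  refine subset_cl.antisymm' ?_
  rintro p ⟨i, g, j, hp, hl, hw⟩
  refine ⟨i, g, j, hp, hl.lift fun a ha i g j h => (h.mem_cl_iff.1 ha).1, fun ht => ?_⟩
  have H : ∀ {i g j}, LabelledWalk (cl Z) i g j → LabelledWalk Z i g j := fun w =>
    w.lift fun a ha i g j h => (h.mem_cl_iff.1 ha).2 ht
  exact H (hw fun i g w => ht i g (H w))

theorem excess_insert_of_mem_cl (H : p ∈ cl Z) : excess (insert p Z) = excess Z := by
  have : IsGTrivial (insert p Z) ↔ IsGTrivial Z := by
    refine ⟨IsGTrivial.anti (Set.subset_insert p Z), fun ht => fun i g w => ht i g (w.lift ?_)⟩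
    rintro a ha i g j h
    have ha' : a ∈ cl Z := by
      rcases ha with rfl | ha
      · exact H
      · exact subset_cl ha
    exact (h.mem_cl_iff.1 ha').2 ht
  exact excess_congr this

theorem numClasses_insert_of_mem_cl (H : p ∈ cl Z) :
    numClasses (insert p Z) = numClasses Z := by
  obtain ⟨u, g, v, hp, hl, -⟩ := H
  exact numClasses_insert_of_linked hp hl

/-- Rank grows by one, stated without subtraction. Either `p` merges two classes and G-triviality is
unaffected, or `Z` is G-trivial and the label of `p` contradicts a walk between its ends. -/
theorem rank_insert_of_notMem_cl (H : p ∉ cl Z) :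
    numClasses (insert p Z) + excess Z + 1 = numClasses Z + excess (insert p Z) := by
  obtain ⟨u, g, v, hp⟩ := exists_arrow p
  by_cases hl : Linked Z u v
  · rw [hp.mem_cl_iff] at H
    push Not at H
    obtain ⟨ht, hw⟩ := H hl
    obtain ⟨h, w⟩ := hl
    have hnt : ¬ IsGTrivial (insert p Z) := fun ht' => by
      have h₁ := w.mono (Set.subset_insert p Z)
      have h₂ := LabelledWalk.single (Set.mem_insert p Z) hp
      exact hw (ht'.label_unique h₁ h₂ ▸ w)
    rw [numClasses_insert_of_linked hp ⟨h, w⟩, excess, excess, if_pos ht, if_neg hnt]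
  · have h₁ := numClasses_insert_of_not_linked hp hl
    have h₂ : excess (insert p Z) = excess Z := by
      have : IsGTrivial (insert p Z) ↔ IsGTrivial Z :=
        ⟨IsGTrivial.anti (Set.subset_insert p Z), fun ht => ht.insert_of_not_linked hp hl⟩
      exact excess_congr this
    omega

theorem isGTrivial_empty : IsGTrivial (∅ : Set (Vert n G)) :=
  isGTrivial_of_potential 1 fun _ ha => ha.elim

variable [Finite G]

theorem rank_le_ncard (Z : Set (Vert n G)) : n + excess Z ≤ Z.ncard + numClasses Z := by
  induction Z, Z.toFinite using Set.Finite.induction_on with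
  | empty => simp [numClasses_empty, excess, isGTrivial_empty]
  | @insert p Z hpZ hZ ih =>
    rw [Set.ncard_insert_of_notMem hpZ hZ]
    by_cases H : p ∈ cl Z
    · rw [excess_insert_of_mem_cl H, numClasses_insert_of_mem_cl H]
      omega
    · have := rank_insert_of_notMem_cl H
      omega

theorem empty_mem_rhodes : ∅ ∈ rhodes n G := by
  rw [mem_rhodes_iff, numClasses_empty, Set.ncard_empty]
  omega

theorem insert_mem_rhodes_iff (hp : p ∉ Z) :
    insert p Z ∈ rhodes n G ↔ Z ∈ rhodes n G ∧ p ∉ cl Z := by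
  have h₀ := rank_le_ncard Z
  rw [mem_rhodes_iff, mem_rhodes_iff, Set.ncard_insert_of_notMem hp Z.toFinite]
  by_cases H : p ∈ cl Z
  · rw [excess_insert_of_mem_cl H, numClasses_insert_of_mem_cl H]
    simp only [H, not_true, and_false, iff_false]
    omega
  · have := rank_insert_of_notMem_cl H
    simp only [H, not_false_eq_true, and_true]
    omega

theorem insert_mem_rhodes (hZ : Z ∈ rhodes n G) (hp : p ∉ cl Z) : insert p Z ∈ rhodes n G :=
  (insert_mem_rhodes_iff fun h => hp (subset_cl h)).2 ⟨hZ, hp⟩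

/-- Every set contains a face with the same closure. -/
theorem exists_basis (Z : Set (Vert n G)) : ∃ Y ⊆ Z, Y ∈ rhodes n G ∧ cl Y = cl Z := by
  obtain ⟨Y, ⟨hY, hYZ⟩, hmax⟩ := Set.Finite.exists_maximal
    (Set.toFinite {Y | Y ∈ rhodes n G ∧ Y ⊆ Z}) ⟨∅, empty_mem_rhodes, Set.empty_subset Z⟩
  refine ⟨Y, hYZ, hY, (cl_mono hYZ).antisymm ?_⟩
  rw [← cl_cl Y]
  refine cl_mono fun p hp => ?_
  by_contra hpY
  have := hmax ⟨insert_mem_rhodes hY hpY, Set.insert_subset hp hYZ⟩ (Set.subset_insert p Y)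
  exact hpY (subset_cl (this (Set.mem_insert p Y)))

/-- Membership in `T(H_k)` in terms of the closure. -/
theorem mem_truncFlats_iff (k : ℕ) :
    T ∈ truncFlats (rhodes n G) (k + 1) ↔ ∀ X ⊆ T, X.ncard ≤ k → cl X ⊆ T := by
  constructor
  · intro H X hX hk p hp
    by_contra hpT
    -- The definition of T(H_k) speaks only of faces, so `X` is replaced by a face in it with the
    -- same closure.
    obtain ⟨Y, hYX, hY, hcl⟩ := exists_basis X
    have hYk : Y.encard ≤ (k : ℕ∞) := by
      rw [← Y.toFinite.cast_ncard_eq]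
      exact_mod_cast (Set.ncard_le_ncard hYX).trans hk
    have := (H Y ⟨hY, hYk⟩ (hYX.trans hX) p hpT).1
    exact ((insert_mem_rhodes_iff fun h => hpT (hX (hYX h))).1 this).2 (hcl ▸ hp)
  · rintro H X ⟨hX, hk⟩ hXT p hp
    simp only [Nat.add_sub_cancel] at hk
    have hk' : X.ncard ≤ k := by
      rw [← X.toFinite.cast_ncard_eq] at hk
      exact_mod_cast hk
    refine ⟨insert_mem_rhodes hX fun h => hp (H X hXT hk' h), ?_⟩
    push_cast
    exact (Set.encard_insert_le X p).trans (by gcongr)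

theorem cl_mem_truncFlats (Z : Set (Vert n G)) (k : ℕ) :
    cl Z ∈ truncFlats (rhodes n G) (k + 1) := by
  rw [mem_truncFlats_iff]
  intro X hX _
  rw [← cl_cl Z]
  exact cl_mono hX

theorem truncFlats_anti {k m : ℕ} (h : k ≤ m) :
    truncFlats (rhodes n G) (m + 1) ⊆ truncFlats (rhodes n G) (k + 1) := fun T hT => by
  rw [mem_truncFlats_iff] at hT ⊢
  exact fun X hX hk => hT X hX (hk.trans h)

end Closure

/-! ### Transversals of chains -/

section Transversals

variable {V : Type*} {R S : Set (Set V)}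

theorem transversals_mono (H : R ⊆ S) : transversals R ⊆ transversals S := by
  rintro X ⟨m, c, x, hc, h⟩
  exact ⟨m, c, x, fun i => H (hc i), h⟩

/-- Extending a chain at its upper end. -/
theorem exists_chain_snoc {X : Set V} {m : ℕ} {c : Fin (m + 1) → Set V} {x : Fin m → V}
    (hR : ∀ i, c i ∈ R) (hc : StrictMono c) (hx : ∀ i : Fin m, x i ∈ c i.succ \ c i.castSucc)
    (hX : X = Set.range x) {F : Set V} (hF : F ∈ R) (hcF : c (Fin.last m) ⊆ F) {p : V}
    (hp : p ∈ F \ c (Fin.last m)) :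
    ∃ (c' : Fin (m + 2) → Set V) (x' : Fin (m + 1) → V), (∀ i, c' i ∈ R) ∧ StrictMono c' ∧
      (∀ i : Fin (m + 1), x' i ∈ c' i.succ \ c' i.castSucc) ∧ insert p X = Set.range x' ∧
      c' (Fin.last (m + 1)) = F := by
  refine ⟨Fin.snoc (α := fun _ => Set V) c F, Fin.snoc (α := fun _ => V) x p, ?_, ?_, ?_, ?_, ?_⟩
  · intro i
    refine Fin.lastCases ?_ (fun i => ?_) i
    · simpa using hF
    · simpa using hR i
  · rw [Fin.strictMono_iff_lt_succ]
    intro i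
    refine Fin.lastCases ?_ (fun i => ?_) i
    · rw [Fin.succ_last, Fin.snoc_last, Fin.snoc_castSucc]
      exact LE.le.ssubset_of_mem_notMem hcF hp.1 hp.2
    · rw [Fin.succ_castSucc, Fin.snoc_castSucc, Fin.snoc_castSucc]
      exact hc i.castSucc_lt_succ
  · intro i
    refine Fin.lastCases ?_ (fun i => ?_) i
    · rw [Fin.succ_last, Fin.snoc_last, Fin.snoc_castSucc, Fin.snoc_last]
      exact hp
    · rw [Fin.succ_castSucc, Fin.snoc_castSucc, Fin.snoc_castSucc, Fin.snoc_castSucc]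
      exact hx i
  · rw [Fin.range_snoc, hX]
  · exact Fin.snoc_last _ _

end Transversals

/-! ### The two inclusions, the bound 4 and its optimality -/

section Main

variable {n : ℕ} {G : Type*} [Group G] {Z W T X : Set (Vert n G)} {a b c e p q : Vert n G}
  {i j k l x y u v : Fin n} {g h : G}

/-- Each new element of a transversal avoids a closed set containing the earlier ones, hence avoids
their closure. -/
theorem transversals_subset_rhodes [Finite G] {R : Set (Set (Vert n G))}
    (H : ∀ T ∈ R, cl T ⊆ T) : transversals R ⊆ rhodes n G := by
  rintro X ⟨m, c, x, hR, hc, hx, rfl⟩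
  have key : ∀ t : ℕ, ∀ ht : t < m + 1,
      x '' {i | (i : ℕ) < t} ∈ rhodes n G ∧ x '' {i | (i : ℕ) < t} ⊆ c ⟨t, ht⟩ := by
    intro t
    induction t with
    | zero => simp [empty_mem_rhodes]
    | succ t ih =>
      intro ht
      have ht' : t < m := by omega
      obtain ⟨h₁, h₂⟩ := ih (by omega)
      have h₃ := hx ⟨t, ht'⟩
      have heq : x '' {i | (i : ℕ) < t + 1} =
          insert (x ⟨t, ht'⟩) (x '' {i | (i : ℕ) < t}) := by
        rw [← Set.image_insert_eq]
        congr 1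
        ext i
        simp only [Set.mem_ofPred_eq, Set.mem_insert_iff, Fin.ext_iff]
        omega
      rw [heq]
      refine ⟨insert_mem_rhodes h₁ fun h => h₃.2 (H _ (hR _) (cl_mono h₂ h)),
        Set.insert_subset h₃.1 (h₂.trans (hc.monotone ?_))⟩
      simp [Fin.le_def]
  have := (key m (by omega)).1
  rwa [show {i : Fin m | (i : ℕ) < m} = Set.univ by ext; simp, Set.image_univ] at this

theorem rhodes_subset_transversals [Finite G] {R : Set (Set (Vert n G))} (H : ∀ Z, cl Z ∈ R) :
    rhodes n G ⊆ transversals R := by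
  -- Requiring the chain to end at `cl X` is what lets the induction continue: the next element of
  -- the face lies outside it.
  have key : ∀ X : Set (Vert n G), X ∈ rhodes n G → ∃ (m : ℕ) (c : Fin (m + 1) → Set (Vert n G))
      (x : Fin m → Vert n G), (∀ i, c i ∈ R) ∧ StrictMono c ∧
      (∀ i : Fin m, x i ∈ c i.succ \ c i.castSucc) ∧ X = Set.range x ∧
      c (Fin.last m) = cl X := by
    intro X
    induction X, X.toFinite using Set.Finite.induction_on with
    | empty =>
      exact fun _ => ⟨0, fun _ => cl ∅, Fin.elim0, fun _ => H ∅, fun i j h => absurd h (by omega),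
        fun i => i.elim0, by simp, rfl⟩
    | @insert p X hpX _ ih =>
      intro hX
      obtain ⟨hX, hp⟩ := (insert_mem_rhodes_iff hpX).1 hX
      obtain ⟨m, c, x, hR, hc, hx, hr, hl⟩ := ih hX
      obtain ⟨c', x', h⟩ := exists_chain_snoc hR hc hx hr (H (insert p X))
        (hl ▸ cl_mono (Set.subset_insert p X))
        ⟨subset_cl (Set.mem_insert p X), hl ▸ hp⟩
      exact ⟨m + 1, c', x', h⟩
  intro X hX
  obtain ⟨m, c, x, h₁, h₂, h₃, h₄, -⟩ := key X hX
  exact ⟨m, c, x, h₁, h₂, h₃, h₄⟩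

theorem not_isGTrivial_of_ne (ha : a ∈ Z) (hb : b ∈ Z) (hab : a ≠ b) (h₁ : Arrow a i g j)
    (h₂ : Arrow b i h j) : ¬ IsGTrivial Z := fun ht =>
  hab (h₁.eq (ht.label_unique (.single ha h₁) (.single hb h₂) ▸ h₂))

theorem Arrow.of_supp_eq (h₁ : Arrow a i g j) (h : a.1.supp = b.1.supp) :
    ∃ g', Arrow b i g' j :=
  arrow_of_mem_supp (h ▸ h₁.1) (h ▸ h₁.2.1) h₁.ne

/-- A set closed under taking closures of three-element subsets is closed. -/
theorem cl_subset_of_ncard_le_three [Nontrivial G] (H : ∀ X ⊆ T, X.ncard ≤ 3 → cl X ⊆ T) :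
    cl T ⊆ T := by
  have H₃ : ∀ a ∈ T, ∀ b ∈ T, ∀ c ∈ T, cl {a, b, c} ⊆ T := fun a ha b hb c hc =>
    H _ (by simp [Set.insert_subset_iff, ha, hb, hc]) ((Set.ncard_insert_le _ _).trans
      (Nat.succ_le_succ ((Set.ncard_insert_le _ _).trans (by rw [Set.ncard_singleton]))))
  -- Two parallel edges are G-nontrivial, so together with any third edge their closure ignores
  -- labels.
  by_cases hd : ∃ a ∈ T, ∃ b ∈ T, a ≠ b ∧ a.1.supp = b.1.supp
  · obtain ⟨a, ha, b, hb, hab, hs⟩ := hd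
    obtain ⟨u, g, v, hu⟩ := exists_arrow a
    obtain ⟨g', hv⟩ := hu.of_supp_eq hs
    have full : ∀ e ∈ T, ∀ p : Vert n G, ∀ i h h' j, Arrow e i h j → Arrow p i h' j → p ∈ T :=
      fun e he p i h h' j hij hp => H₃ a ha b hb e he <| hp.mem_cl_iff.2
        ⟨hij.linked (by simp), fun ht =>
          (not_isGTrivial_of_ne (by simp) (by simp) hab hu hv ht).elim⟩
    -- Adjacency in `T` is transitive: `full` supplies a parallel `e₂` of the first edge `e`, and
    -- the triple `e`, `e₂`, `e'` is G-nontrivial and links `i` to `j`.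
    have conn : ∀ i g j, LabelledWalk T i g j → i ≠ j → ∃ e ∈ T, ∃ h, Arrow e i h j := by
      intro i g j w
      induction w with
      | nil => exact fun h => (h rfl).elim
      | @cons i k j g _ e he hg _ ih =>
        intro hij
        by_cases hk : k = j
        · subst hk
          exact ⟨e, he, g, hg⟩
        · obtain ⟨e', he', h', hk'⟩ := ih hk
          obtain ⟨g₂, hne⟩ : ∃ g₂, g₂ ≠ g := exists_ne g
          obtain ⟨e₂, he₂⟩ := exists_vert hg.ne g₂
          obtain ⟨p, hp⟩ := exists_vert (n := n) hij (1 : G)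
          refine ⟨p, H₃ e he e₂ (full e he e₂ _ _ _ _ hg he₂) e' he' (hp.mem_cl_iff.2
            ⟨(hg.linked (by simp)).trans (hk'.linked (by simp)), fun ht =>
              (not_isGTrivial_of_ne (by simp) (by simp) ?_ hg he₂ ht).elim⟩), 1, hp⟩
          rintro rfl
          exact hne (he₂.label_unique hg)
    rintro p ⟨i, h, j, hp, ⟨h', w⟩, -⟩
    obtain ⟨e, he, h', hij⟩ := conn i h' j w hp.ne
    exact full e he p _ _ _ _ hij hp
  · push Not at hd
    -- Without parallel edges, two consecutive arrows either cancel or have their product in `T`, so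
    -- every walk collapses to one arrow or to nothing.
    have key : ∀ i g j, LabelledWalk T i g j →
        (i = j → g = 1) ∧ (i ≠ j → ∃ e ∈ T, Arrow e i g j) := by
      intro i g j w
      induction w with
      | nil => exact ⟨fun _ => rfl, fun h => (h rfl).elim⟩
      | @cons i k j g h e he hg _ ih =>
        by_cases hk : k = j
        · subst hk
          rw [ih.1 rfl, mul_one]
          exact ⟨fun h => (hg.ne h).elim, fun _ => ⟨e, he, hg⟩⟩
        · obtain ⟨e', he', hk'⟩ := ih.2 hk
          refine ⟨?_, fun hij => ?_⟩
          · rintro rfl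
            have hee : e = e' := by
              by_contra hne
              exact hd e he e' he' hne (by rw [hg.supp_eq, hk'.symm.supp_eq])
            subst hee
            rw [hg.label_unique hk'.symm, inv_mul_cancel]
          · obtain ⟨p, hp⟩ := exists_vert (n := n) hij (g * h)
            have w : LabelledWalk {e, e', e'} i (g * h) j :=
              (LabelledWalk.single (by simp) hg).append (.single (by simp) hk')
            exact ⟨p, H₃ e he e' he' e' he' (hp.mem_cl_iff.2 ⟨⟨_, w⟩, fun _ => w⟩), hp⟩
    have ht : IsGTrivial T := fun i g w => (key i g i w).1 rfl
    rintro p ⟨i, g, j, hp, -, hw⟩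
    obtain ⟨e, he, he'⟩ := (key i g j (hw ht)).2 hp.ne
    exact hp.eq he' ▸ he

theorem cl_subset_of_mem_truncFlats [Finite G] [Nontrivial G] {k : ℕ} (hk : 4 ≤ k)
    (hT : T ∈ truncFlats (rhodes n G) k) : cl T ⊆ T := by
  obtain ⟨k, rfl⟩ : ∃ m, k = m + 1 := ⟨k - 1, by omega⟩
  rw [mem_truncFlats_iff] at hT
  exact cl_subset_of_ncard_le_three fun X hX h => hT X hX (by omega)

/-- In a matching, a walk can only go back and forth along one edge. -/
theorem cl_subset_of_pairwise_disjoint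
    (H : ∀ a ∈ Z, ∀ b ∈ Z, a ≠ b → Disjoint a.1.supp b.1.supp) : cl Z ⊆ Z := by
  have key : ∀ i g j, LabelledWalk Z i g j → (i = j ∧ g = 1) ∨ ∃ e ∈ Z, Arrow e i g j := by
    intro i g j w
    induction w with
    | nil => exact .inl ⟨rfl, rfl⟩
    | @cons i k j g h e he hg _ ih =>
      rcases ih with ⟨rfl, rfl⟩ | ⟨e', he', hk⟩
      · exact .inr ⟨e, he, by simpa using hg⟩
      · obtain rfl : e = e' := by
          by_contra hne
          exact Finset.disjoint_left.1 (H e he e' he' hne) hg.2.1 hk.1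
        rcases hg.cases hk with ⟨rfl, rfl, rfl⟩ | ⟨rfl, -, rfl⟩
        · exact (hg.ne rfl).elim
        · exact .inl ⟨rfl, inv_mul_cancel h⟩
  have ht : IsGTrivial Z := fun i g w => by
    rcases key i g i w with h | ⟨e, -, h⟩
    · exact h.2
    · exact (h.ne rfl).elim
  rintro p ⟨i, g, j, hp, -, hw⟩
  rcases key i g j (hw ht) with ⟨rfl, -⟩ | ⟨e, he, h⟩
  · exact (hp.ne rfl).elim
  · exact hp.eq h ▸ he

theorem supp_eq_of_mem_cl {S : Finset (Fin n)} (H : ∀ a ∈ Z, a.1.supp = S) (hp : p ∈ cl Z) :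
    p.1.supp = S := by
  have key : ∀ i j, Linked Z i j → i ≠ j → i ∈ S ∧ S.card = 2 := by
    rintro i j ⟨g, w⟩ hij
    cases w with
    | nil => exact (hij rfl).elim
    | cons e he hg _ => exact H e he ▸ ⟨hg.1, e.2.1⟩
  obtain ⟨u, g, v, huv, hl, -⟩ := hp
  refine Finset.eq_of_subset_of_card_le ?_ (by rw [(key _ _ hl huv.ne).2, p.2.1])
  rw [huv.supp_eq, Finset.insert_subset_iff, Finset.singleton_subset_iff]
  exact ⟨(key _ _ hl huv.ne).1, (key _ _ hl.symm huv.ne.symm).1⟩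

theorem mem_truncFlats_of_cl_subset [Finite G] (H : cl T ⊆ T) (k : ℕ) :
    T ∈ truncFlats (rhodes n G) (k + 1) :=
  H.antisymm subset_cl ▸ cl_mem_truncFlats T k

/-- Two disjoint pairs of parallel edges form a transversal of a chain in `T(H_3)`, but not a
face. -/
theorem not_transversals_subset_rhodes [Finite G] [Nontrivial G] (hn : 4 ≤ n) :
    ¬ transversals (truncFlats (rhodes n G) 3) ⊆ rhodes n G := by
  obtain ⟨g, hg⟩ := exists_ne (1 : G)
  let i : Fin n := ⟨0, by omega⟩
  let j : Fin n := ⟨1, by omega⟩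
  let k : Fin n := ⟨2, by omega⟩
  let l : Fin n := ⟨3, by omega⟩
  have hij : i ≠ j := by simp [i, j]
  have hkl : k ≠ l := by simp [k, l]
  have hdisj : Disjoint ({k, l} : Finset (Fin n)) {i, j} := by simp [i, j, k, l]
  obtain ⟨a, ha⟩ := exists_vert hij (1 : G)
  obtain ⟨b, hb⟩ := exists_vert hij g
  obtain ⟨c, hc⟩ := exists_vert hkl (1 : G)
  obtain ⟨d, hd⟩ := exists_vert hkl g
  have hba : b ≠ a := by
    rintro rfl
    exact hg (hb.label_unique ha)
  have hdc : d ≠ c := by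
    rintro rfl
    exact hg (hd.label_unique hc)
  -- `F` is a flat containing `a` and `b`. The two parallel pairs give two unicyclic components, so
  -- `{a, b, c, d}` is not a face.
  let F : Set (Vert n G) := {p | p.1.supp = {i, j}}
  have haF : a ∈ F := ha.supp_eq
  have hbF : b ∈ F := hb.supp_eq
  have hF : ∀ p : Vert n G, p.1.supp = {k, l} → p ∉ F := by
    intro p hp (hpF : p.1.supp = {i, j})
    rw [← hp, ← hpF, disjoint_self, Finset.bot_eq_empty] at hdisj
    simpa [hdisj] using p.2.1
  have hcF : c ∉ F := hF c hc.supp_eq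
  have hdF : d ∉ F := hF d hd.supp_eq
  have hX : ({a, b, c, d} : Set (Vert n G)) ∉ rhodes n G := by
    have : ({a, b, c, d} : Set (Vert n G)) = insert d {a, b, c} := by
      ext; simp only [Set.mem_insert_iff, Set.mem_singleton_iff]; tauto
    rw [this, insert_mem_rhodes_iff]
    · refine fun h => h.2 (hd.mem_cl_iff.2 ⟨hc.linked (by simp), fun ht => ?_⟩)
      exact (not_isGTrivial_of_ne (by simp) (by simp) hba.symm ha hb ht).elim
    · have hda : d ≠ a := fun h => hdF (h ▸ haF)
      have hdb : d ≠ b := fun h => hdF (h ▸ hbF)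
      simp [hda, hdb, hdc]
  refine fun H => hX (H ⟨4, ![∅, {a}, F, insert c F, Set.univ], ![a, b, c, d], ?_, ?_, ?_, ?_⟩)
  · have h₀ : ∅ ∈ truncFlats (rhodes n G) 3 :=
      mem_truncFlats_of_cl_subset (cl_subset_of_pairwise_disjoint (by simp)) 2
    have h₁ : {a} ∈ truncFlats (rhodes n G) 3 :=
      mem_truncFlats_of_cl_subset (cl_subset_of_pairwise_disjoint (by simp)) 2
    have h₂ : F ∈ truncFlats (rhodes n G) 3 :=
      mem_truncFlats_of_cl_subset (fun p hp => supp_eq_of_mem_cl (fun _ h => h) hp) 2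
    -- This set is not a flat: `d` lies in the closure of `a`, `b`, `c`. But a subset with at most
    -- two elements is either inside `F` or a matching containing `c`.
    have h₃ : insert c F ∈ truncFlats (rhodes n G) 3 := by
      rw [mem_truncFlats_iff]
      intro X hX hX2
      by_cases hcX : c ∈ X
      · refine (cl_subset_of_pairwise_disjoint fun p hp q hq hpq => ?_).trans hX
        have h1 : (X \ {c}).ncard ≤ 1 := by
          have := Set.ncard_sdiff_singleton_add_one hcX
          omega
        rw [Set.ncard_le_one] at h1
        by_cases hpc : p = c
        · subst hpc
          have hqF : q.1.supp = {i, j} := (hX hq).resolve_left hpq.symm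
          rwa [hc.supp_eq, hqF]
        · have hpF : p.1.supp = {i, j} := (hX hp).resolve_left hpc
          by_cases hqc : q = c
          · subst hqc
            rw [hc.supp_eq, hpF]
            exact hdisj.symm
          · exact (hpq (h1 p ⟨hp, hpc⟩ q ⟨hq, hqc⟩)).elim
      · have hXF : ∀ p ∈ X, p ∈ F := fun p hp =>
          (hX hp).resolve_left fun h => hcX (h ▸ hp)
        exact fun p hp => .inr (supp_eq_of_mem_cl hXF hp)
    have h₄ : Set.univ ∈ truncFlats (rhodes n G) 3 :=
      mem_truncFlats_of_cl_subset (Set.subset_univ _) 2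
    intro t
    fin_cases t <;> assumption
  · rw [Fin.strictMono_iff_lt_succ]
    have h₀ : ∅ ⊂ ({a} : Set (Vert n G)) := by simp
    have h₁ : {a} ⊂ F :=
      (Set.singleton_subset_iff.2 haF).ssubset_of_mem_notMem hbF hba
    have h₂ : F ⊂ insert c F := Set.ssubset_insert hcF
    have h₃ : insert c F ⊂ Set.univ :=
      (Set.subset_univ _).ssubset_of_mem_notMem (Set.mem_univ d) (by simp [hdc, hdF])
    intro t
    fin_cases t <;> assumption
  · have h₀ : a ∈ ({a} : Set (Vert n G)) \ ∅ := by simp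
    have h₁ : b ∈ F \ {a} := ⟨hbF, hba⟩
    have h₂ : c ∈ insert c F \ F := ⟨Set.mem_insert c F, hcF⟩
    have h₃ : d ∈ Set.univ \ insert c F := ⟨Set.mem_univ d, by simp [hdc, hdF]⟩
    intro t
    fin_cases t <;> assumption
  · simp only [Matrix.range_cons, Matrix.range_empty, Set.union_empty, Set.singleton_union]

end Main

end ReducedRhodes

open ReducedRhodes in
theorem mainTheorem10 {G : Type*} [Group G] [Finite G] [Nontrivial G] (n : ℕ) (hn : 2 ≤ n) :
    (∀ k : ℕ, 4 ≤ k →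
      ReducedRhodes.rhodes n G =
        ReducedRhodes.transversals (ReducedRhodes.truncFlats (ReducedRhodes.rhodes n G) k)) ∧
    (4 ≤ n → ∀ k : ℕ, 1 ≤ k → k ≤ 3 →
      ReducedRhodes.rhodes n G ≠
        ReducedRhodes.transversals (ReducedRhodes.truncFlats (ReducedRhodes.rhodes n G) k)) := by
  refine ⟨fun k hk => ?_, fun hn k hk hk' h => ?_⟩
  · obtain ⟨m, rfl⟩ : ∃ m, k = m + 1 := ⟨k - 1, by omega⟩
    exact (rhodes_subset_transversals fun Z => cl_mem_truncFlats Z m).antisymm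
      (transversals_subset_rhodes fun T hT => cl_subset_of_mem_truncFlats hk hT)
  · obtain ⟨m, rfl⟩ : ∃ m, k = m + 1 := ⟨k - 1, by omega⟩
    refine not_transversals_subset_rhodes (n := n) (G := G) hn ?_
    -- T(H_3) ⊆ T(H_k) for 1 ≤ k ≤ 3, so the example for 3 refutes all these k at once.
    exact (transversals_mono (truncFlats_anti (by omega : m ≤ 2))).trans h.symm.subset
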